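/- **Theorem (Quantitative One-for-all Theorem for two families).** Let $\mathcal C^n$ be the family of all $n$-dimensional closed convex subsets of $\mathbb R^n$. For $f\in\mathbb R^n\setminus\mathbb Z^n$, $B\in\mathcal C^n$ with $f\in\operatorname{int}(B)$, let $\psi_{B-f}(r)=\inf\{\lambda>0: r\in\lambda(B-f)\}$, and for $R=(r_1,\dots,r_k)\in\mathbb R^{n\times k}$, $k\ge 1$, let $$C_B(R,f)=\Big\{s\in\mathbb R^k_{\ge0}:\ \sum_{i=1}^k s_i\,\psi_{B-f}(r_i)\ge 1\Big\};$$ if $f\notin\operatorname{int}(B)$, let $C_B(R,f)=\mathbb R^k_{\ge 0}$. For $\mathcal B\subseteq\mathcal C^n$ let $C_{\mathcal B}(R,f)=\bigcap_{B\in\mathcal B}C_B(R,f)$, which is $\mathbb R^k_{\ge0}$ if $\mathcal B=\emptyset$. Put $$\rho_f(B,L)=\inf\{\alpha>0:\ C_B(R,f)\subseteq\tfrac1\alpha C_L(R,f)\text{ for all }R\},\qquad \rho_f(\mathcal B,\mathcal L)=\inf\{\alpha>0:\ C_{\mathcal B}(R,f)\subseteq\tfrac1\alpha C_{\mathcal L}(R,f)\text{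 for all }R\},$$ where $R$ ranges over all real matrices with $n$ rows and at least one column, and $\rho(\mathcal B,\mathcal L)=\sup_{f\in\mathbb R^n\setminus\mathbb Z^n}\rho_f(\mathcal B,\mathcal L)$. All values lie in $[0,\infty]$, with $\inf\emptyset=\infty$, $\sup\emptyset=0$. The family $\mathcal B$ is called $f$-closed if $\{\psi_{B-f}:B\in\mathcal B,\ f\in\operatorname{int}(B)\}$ is closed under pointwise convergence within $\{\psi_{C-f}:C\in\mathcal C^n,\ f\in\operatorname{int}(C)\}$. Let $\mathcal B,\mathcal L\subseteq\mathcal C^n$ and let $N\ge 1$ be an integer such that every $L\in\mathcal L$ can be written as $L=\operatorname{conv}(V)+\operatorname{cone}(W)$ with a nonempty finite set $V\subset\mathbb R^n$ and a finite (possibly empty) set $W\subset\mathbb R^n\setminus\{0\}$ such that $|V|+|W|+1\le N$ (here $\operatorname{cone}(W)$ is the set of all nonnegative linear combinations of elements of $W$). Then the following hold. (a) Let $f\in\mathbb R^n\setminus\mathbb Z^n$ and suppose that $\mathcal B$ is $f$-closed. Then $$\frac1N\,\sup_{L\in\mathcal L}\,\inf_{B\in\mathcal B}\rho_f(B,L)\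 \le\ \rho_f(\mathcal B,\mathcal L)\ \le\ \sup_{L\in\mathcal L}\,\inf_{B\in\mathcal B}\rho_f(B,L),$$ where for the first inequality it is assumed that $\mathcal B\neq\emptyset$ or that $f\in\operatorname{int}(L)$ for some $L\in\mathcal L$. (b) Suppose that $\mathcal B$ is $f$-closed for every $f\in\mathbb R^n\setminus\mathbb Z^n$. Then $$\frac1N\,\sup_{\substack{L\in\mathcal L\\ f\in\operatorname{int}(L)\setminus\mathbb Z^n}}\,\inf_{B\in\mathcal B}\rho_f(B,L)\ \le\ \rho(\mathcal B,\mathcal L)\ \le\ \sup_{\substack{L\in\mathcal L\\ f\in\operatorname{int}(L)\setminus\mathbb Z^n}}\,\inf_{B\in\mathcal B}\rho_f(B,L).$$ -/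

import Mathlib

open scoped ENNReal Pointwise

noncomputable section

/-- The family of all `n`-dimensional closed convex subsets of `ℝⁿ`
(the dimension of a convex set is the dimension of its affine hull). -/
def FullDimClosedConvex (n : ℕ) : Set (Set (EuclideanSpace ℝ (Fin n))) :=
  {C | IsClosed C ∧ Convex ℝ C ∧ affineSpan ℝ C = ⊤}

/-- The lattice `ℤⁿ` inside `ℝⁿ`. -/
def integerLattice (n : ℕ) : Set (EuclideanSpace ℝ (Fin n)) :=
  {x | ∀ i, ∃ z : ℤ, x i = z}

/-- The gauge function `ψ_{B - f}` of the translate `B - f`, that is,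
`r ↦ inf {t > 0 | r ∈ t (B - f)}`. -/
def gaugeAt {n : ℕ} (f : EuclideanSpace ℝ (Fin n)) (B : Set (EuclideanSpace ℝ (Fin n))) :
    EuclideanSpace ℝ (Fin n) → ℝ :=
  gauge ((fun x => x - f) '' B)

/-- The cut `C_B(R, f)` generated by `B`, where `R` is given by its `k` columns. If `f` is not an
interior point of `B`, this is the whole nonnegative orthant. -/
def cut {n k : ℕ} (B : Set (EuclideanSpace ℝ (Fin n))) (R : Fin k → EuclideanSpace ℝ (Fin n))
    (f : EuclideanSpace ℝ (Fin n)) : Set (Fin k → ℝ) :=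
  {s | (∀ i, 0 ≤ s i) ∧ (f ∈ interior B → 1 ≤ ∑ i, s i * gaugeAt f B (R i))}

/-- The closure `C_𝓑(R, f)`: the intersection of all cuts `C_B(R, f)` with `B ∈ 𝓑`; for the empty
family it is the nonnegative orthant. -/
def cutClosure {n k : ℕ} (𝓑 : Set (Set (EuclideanSpace ℝ (Fin n))))
    (R : Fin k → EuclideanSpace ℝ (Fin n)) (f : EuclideanSpace ℝ (Fin n)) : Set (Fin k → ℝ) :=
  {s | (∀ i, 0 ≤ s i) ∧ ∀ B ∈ 𝓑, s ∈ cut B R f}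

/-- `ρ_f(B, L) = inf {α > 0 | C_B(R, f) ⊆ (1/α) C_L(R, f) for every R}`, an element of `[0, ∞]`;
here `R` ranges over all real matrices with `n` rows and at least one column. -/
def rhoSets {n : ℕ} (f : EuclideanSpace ℝ (Fin n)) (B L : Set (EuclideanSpace ℝ (Fin n))) :
    ℝ≥0∞ :=
  ⨅ (α : ℝ) (_ : 0 < α ∧ ∀ k : ℕ, 1 ≤ k → ∀ R : Fin k → EuclideanSpace ℝ (Fin n),
    cut B R f ⊆ (1 / α) • cut L R f), ENNReal.ofReal α

/-- `ρ_f(𝓑, 𝓛) = inf {α > 0 | C_𝓑(R, f) ⊆ (1/α) C_𝓛(R, f) for every R}`, an element of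
`[0, ∞]`. -/
def rhoFamilies {n : ℕ} (f : EuclideanSpace ℝ (Fin n))
    (𝓑 𝓛 : Set (Set (EuclideanSpace ℝ (Fin n)))) : ℝ≥0∞ :=
  ⨅ (α : ℝ) (_ : 0 < α ∧ ∀ k : ℕ, 1 ≤ k → ∀ R : Fin k → EuclideanSpace ℝ (Fin n),
    cutClosure 𝓑 R f ⊆ (1 / α) • cutClosure 𝓛 R f), ENNReal.ofReal α

/-- `ρ(𝓑, 𝓛) = sup {ρ_f(𝓑, 𝓛) | f ∈ ℝⁿ ∖ ℤⁿ}`. -/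
def rhoAll {n : ℕ} (𝓑 𝓛 : Set (Set (EuclideanSpace ℝ (Fin n)))) : ℝ≥0∞ :=
  ⨆ (f : EuclideanSpace ℝ (Fin n)) (_ : f ∉ integerLattice n), rhoFamilies f 𝓑 𝓛

/-- The gauge functions `ψ_{B - f}` of those members `B` of `𝓑` that contain `f` in the
interior. -/
def gaugeFamily {n : ℕ} (f : EuclideanSpace ℝ (Fin n))
    (𝓑 : Set (Set (EuclideanSpace ℝ (Fin n)))) : Set (EuclideanSpace ℝ (Fin n) → ℝ) :=
  {φ | ∃ B ∈ 𝓑, f ∈ interior B ∧ φ = gaugeAt f B}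

/-- `𝓑` is `f`-closed: the gauge functions of the members of `𝓑` containing `f` in the interior
are closed under pointwise convergence within the gauge functions of all `n`-dimensional closed
convex sets containing `f` in the interior. The limit `Tendsto φ atTop (𝓝 ψ)` is taken in the
product topology, so it is pointwise. -/
def IsFClosed {n : ℕ} (f : EuclideanSpace ℝ (Fin n))
    (𝓑 : Set (Set (EuclideanSpace ℝ (Fin n)))) : Prop :=
  ∀ φ : ℕ → EuclideanSpace ℝ (Fin n) → ℝ, (∀ t, φ t ∈ gaugeFamily f 𝓑) →
    ∀ ψ ∈ gaugeFamily f (FullDimClosedConvex n),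
      Filter.Tendsto φ Filter.atTop (nhds ψ) → ψ ∈ gaugeFamily f 𝓑

/-- `L = conv(V) + cone(W)` for a nonempty finite set `V` and a finite, possibly empty set `W` of
nonzero vectors with `|V| + |W| + 1 ≤ N`. The convex conic hull `cone(W)` consists of all
nonnegative linear combinations of elements of `W`, so that `cone(∅) = {0}`. -/
def HasRepresentation {n : ℕ} (N : ℕ) (L : Set (EuclideanSpace ℝ (Fin n))) : Prop :=
  ∃ V W : Finset (EuclideanSpace ℝ (Fin n)), V.Nonempty ∧ 0 ∉ W ∧ V.card + W.card + 1 ≤ N ∧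
    L = convexHull ℝ (V : Set (EuclideanSpace ℝ (Fin n))) +
      (PointedCone.hull ℝ (W : Set (EuclideanSpace ℝ (Fin n))) :
        Set (EuclideanSpace ℝ (Fin n)))

end

open Filter Topology

/-! The upper bounds are formal: if every `L` is approximated by single members of `𝓑`, then so is
the intersection of the cuts. For the lower bounds, let `α` be admissible for the two closures, with
`f` interior to `L = conv(V) + cone(W)`. Test it on the columns `v - f` and `w`, with weights
`1/(Nα)` and `c`. The gauge of `L - f` is at most `1` on the former and `0` on the latter, so after
scaling by `α` the sum is at most `|V|/N < 1` and the cut of `L` fails. Hence some `B ∈ 𝓑` cuts the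
test point off: its gauge is at most `Nα` at each `v - f` and at most `1/c` at each `w`
(`exists_gaugeAt_le_on_generators`). As `c → ∞` these gauges stay pointwise bounded, and a
subsequence converges to a continuous sublinear limit (`exists_subseq_tendsto`). By `f`-closedness
the limit is the gauge of a member of `𝓑`; being at most `Nα` on `V - f` and zero on `W`, it is at
most `Nα` times the gauge of `L - f`. -/

/-- A nonnegative sublinear functional: subadditive and positively homogeneous. -/
structure IsNonnegSublinear {E : Type*} [AddCommGroup E] [Module ℝ E] (p : E → ℝ) : Prop where
  nonneg : ∀ x, 0 ≤ p x
  add_le : ∀ x y, p (x + y) ≤ p x + p y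
  smul_eq : ∀ t : ℝ, 0 ≤ t → ∀ x, p (t • x) = t * p x

namespace IsNonnegSublinear

variable {E : Type*} [AddCommGroup E] [Module ℝ E] {p : E → ℝ}

theorem map_zero (hp : IsNonnegSublinear p) : p 0 = 0 := by
  simpa using hp.smul_eq 0 le_rfl 0

theorem smul_le (hp : IsNonnegSublinear p) (a : ℝ) (x : E) :
    p (a • x) ≤ |a| * (p x + p (-x)) := by
  rcases le_total 0 a with ha | ha
  · rw [hp.smul_eq a ha, abs_of_nonneg ha]
    exact mul_le_mul_of_nonneg_left (by linarith [hp.nonneg (-x)]) ha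
  · have h : a • x = (-a) • (-x) := by simp
    rw [h, hp.smul_eq (-a) (by linarith), abs_of_nonpos ha]
    exact mul_le_mul_of_nonneg_left (by linarith [hp.nonneg x]) (by linarith)

/-- The values of a nonnegative sublinear functional on a convex hull, taken with a base point,
are at most a common bound on the generators. -/
theorem le_of_mem_convexHull (hp : IsNonnegSublinear p) {V : Set E} {f y : E} {β : ℝ}
    (hV : ∀ v ∈ V, p (v - f) ≤ β) (hy : y ∈ convexHull ℝ V) : p (y - f) ≤ β := by
  have hconv : Convex ℝ {y | p (y - f) ≤ β} := by
    intro x hx y hy a b ha hb hab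
    have h : a • x + b • y - f = a • (x - f) + b • (y - f) := by
      have hf : a • f + b • f = f := by rw [← add_smul, hab, one_smul]
      nth_rewrite 1 [← hf]
      module
    simp only [Set.mem_ofPred_eq] at hx hy ⊢
    rw [h]
    calc p (a • (x - f) + b • (y - f)) ≤ a * p (x - f) + b * p (y - f) := by
          rw [← hp.smul_eq a ha, ← hp.smul_eq b hb]; exact hp.add_le _ _
      _ ≤ a * β + b * β := by gcongr
      _ = β := by rw [← add_mul, hab, one_mul]
  exact convexHull_min (fun v hv => hV v hv) hconv hy

/-- A family of nonnegative sublinear functionals that is bounded at every generator of a cone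
is bounded at every point of the cone. -/
theorem exists_bound_of_mem_hull {ι : Type*} {p : ι → E → ℝ}
    (hp : ∀ t, IsNonnegSublinear (p t)) {W : Set E} {c : ℝ} (hW : ∀ t, ∀ w ∈ W, p t w ≤ c)
    {z : E} (hz : z ∈ PointedCone.hull ℝ W) : ∃ d, ∀ t, p t z ≤ d := by
  induction hz using Submodule.span_induction with
  | mem w hw => exact ⟨c, fun t => hW t w hw⟩
  | zero => exact ⟨0, fun t => (hp t).map_zero.le⟩
  | add x y _ _ hx hy =>
    obtain ⟨a, ha⟩ := hx
    obtain ⟨b, hb⟩ := hy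
    exact ⟨a + b, fun t => ((hp t).add_le x y).trans (add_le_add (ha t) (hb t))⟩
  | smul a x _ hx =>
    obtain ⟨d, hd⟩ := hx
    refine ⟨a * d, fun t => ?_⟩
    have h := (hp t).smul_eq a a.2 x
    change p t ((a : ℝ) • x) ≤ _
    rw [h]
    exact mul_le_mul_of_nonneg_left (hd t) a.2

theorem nonpos_of_mem_hull (hp : IsNonnegSublinear p) {W : Set E} (hW : ∀ w ∈ W, p w ≤ 0)
    {z : E} (hz : z ∈ PointedCone.hull ℝ W) : p z ≤ 0 := by
  induction hz using Submodule.span_induction with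
  | mem w hw => exact hW w hw
  | zero => exact hp.map_zero.le
  | add x y _ _ hx hy => linarith [hp.add_le x y]
  | smul a x _ hx =>
    have h := hp.smul_eq a a.2 x
    change p ((a : ℝ) • x) ≤ _
    rw [h]
    exact mul_nonpos_of_nonneg_of_nonpos a.2 hx

/-- A nonnegative sublinear functional is the gauge of its unit sublevel set. -/
theorem gauge_sublevel (hp : IsNonnegSublinear p) : gauge {x | p x ≤ 1} = p := by
  funext r
  have key : ∀ t : ℝ, 0 < t → (r ∈ t • {x | p x ≤ 1} ↔ p r ≤ t) := by
    intro t ht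
    rw [Set.mem_smul_set_iff_inv_smul_mem₀ ht.ne', Set.mem_ofPred_eq,
      hp.smul_eq _ (inv_nonneg.2 ht.le), inv_mul_le_iff₀ ht, mul_one]
  apply le_antisymm
  -- The slack is needed when `p r = 0`, which is not an admissible dilation factor.
  · refine le_of_forall_pos_le_add fun ε hε => ?_
    have h0 : 0 < p r + ε := by linarith [hp.nonneg r]
    exact gauge_le_of_mem h0.le ((key _ h0).2 (by linarith))
  · have hne : {t : ℝ | 0 < t ∧ r ∈ t • {x | p x ≤ 1}}.Nonempty :=
      ⟨p r + 1, by linarith [hp.nonneg r],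
        (key _ (by linarith [hp.nonneg r])).2 (by linarith)⟩
    exact le_csInf hne fun t ht => (key t ht.1).1 ht.2

end IsNonnegSublinear

/-! ### Compactness of sublinear functionals -/

/-- A sequence of real functions on a separable space that are Lipschitz with a common constant
and pointwise bounded has a pointwise convergent subsequence. -/
theorem exists_subseq_tendsto_of_lipschitz {E : Type*} [PseudoMetricSpace E]
    [TopologicalSpace.SeparableSpace E] [Nonempty E] (p : ℕ → E → ℝ) (K : ℝ) (hK : 0 < K)
    (hlip : ∀ t x y, p t x - p t y ≤ K * dist x y) (c : E → ℝ) (hc : ∀ t x, |p t x| ≤ c x) :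
    ∃ q : E → ℝ, ∃ φ : ℕ → ℕ, StrictMono φ ∧ Tendsto (fun m => p (φ m)) atTop (𝓝 q) := by
  let d := TopologicalSpace.denseSeq E
  -- Tychonoff on a dense sequence replaces the diagonal argument.
  have hcomp : IsCompact (Set.univ.pi fun j : ℕ => Set.Icc (-c (d j)) (c (d j))) :=
    isCompact_univ_pi fun j => isCompact_Icc
  obtain ⟨a, -, φ, hφ, hlim⟩ := hcomp.tendsto_subseq (x := fun t j => p t (d j))
    (fun t j _ => abs_le.1 (hc t (d j)))
  have hcau : ∀ x, ∃ l, Tendsto (fun m => p (φ m) x) atTop (𝓝 l) := by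
    intro x
    apply cauchySeq_tendsto_of_complete
    rw [Metric.cauchySeq_iff']
    intro ε hε
    obtain ⟨j, hj⟩ := (TopologicalSpace.denseRange_denseSeq E).exists_dist_lt x
      (show 0 < ε / (4 * K) by positivity)
    have hKj : K * dist x (d j) < ε / 4 := by
      calc K * dist x (d j) < K * (ε / (4 * K)) := mul_lt_mul_of_pos_left hj hK
        _ = ε / 4 := by field_simp
    have hlj : CauchySeq (fun m => p (φ m) (d j)) := (tendsto_pi_nhds.1 hlim j).cauchySeq
    obtain ⟨M, hM⟩ := Metric.cauchySeq_iff'.1 hlj (ε / 4) (by positivity)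
    refine ⟨M, fun m hm => ?_⟩
    have h := hM m hm
    rw [Real.dist_eq, abs_lt] at h ⊢
    have h1 := hlip (φ m) x (d j)
    have h2 := hlip (φ m) (d j) x
    have h3 := hlip (φ M) x (d j)
    have h4 := hlip (φ M) (d j) x
    rw [dist_comm (d j) x] at h2 h4
    constructor <;> linarith [h.1, h.2]
  choose q hq using hcau
  exact ⟨q, φ, hφ, tendsto_pi_nhds.2 hq⟩

/-- A pointwise bounded family of nonnegative sublinear functionals on `ℝⁿ` is bounded by a
common multiple of the norm. -/
theorem IsNonnegSublinear.exists_uniform_bound {n : ℕ} {ι : Type*}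
    {p : ι → EuclideanSpace ℝ (Fin n) → ℝ} (hp : ∀ t, IsNonnegSublinear (p t))
    (hb : ∀ r, ∃ c, ∀ t, p t r ≤ c) : ∃ K, 0 < K ∧ ∀ t r, p t r ≤ K * ‖r‖ := by
  choose c hc using hb
  let e : Fin n → EuclideanSpace ℝ (Fin n) := fun i => EuclideanSpace.single i 1
  -- Expand in the standard basis; the summand `1` only makes the constant positive.
  refine ⟨1 + ∑ i, |c (e i) + c (-e i)|, by positivity, fun t r => ?_⟩
  have hr : r = ∑ i, r i • e i := by
    ext j
    simp [e, Pi.single_apply]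
  have h1 : p t r ≤ ∑ i, p t (r i • e i) := by
    conv_lhs => rw [hr]
    exact Finset.le_sum_of_subadditive (p t) (hp t).map_zero.le (hp t).add_le _ _
  have h2 : ∀ i ∈ Finset.univ, p t (r i • e i) ≤ |c (e i) + c (-e i)| * ‖r‖ := by
    intro i _
    refine ((hp t).smul_le (r i) (e i)).trans ?_
    rw [mul_comm]
    refine mul_le_mul ((add_le_add (hc _ t) (hc _ t)).trans (le_abs_self _)) ?_
      (abs_nonneg _) (abs_nonneg _)
    exact PiLp.norm_apply_le r i
  calc p t r ≤ ∑ i, |c (e i) + c (-e i)| * ‖r‖ := h1.trans (Finset.sum_le_sum h2)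
    _ = (∑ i, |c (e i) + c (-e i)|) * ‖r‖ := by rw [Finset.sum_mul]
    _ ≤ _ := by gcongr; linarith

/-- A pointwise bounded sequence of nonnegative sublinear functionals on `ℝⁿ` has a subsequence
converging pointwise to a continuous nonnegative sublinear functional. -/
theorem IsNonnegSublinear.exists_subseq_tendsto {n : ℕ}
    {p : ℕ → EuclideanSpace ℝ (Fin n) → ℝ} (hp : ∀ t, IsNonnegSublinear (p t))
    (hb : ∀ r, ∃ c, ∀ t, p t r ≤ c) :
    ∃ q, IsNonnegSublinear q ∧ Continuous q ∧
      ∃ φ : ℕ → ℕ, StrictMono φ ∧ Tendsto (fun m => p (φ m)) atTop (𝓝 q) := by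
  obtain ⟨K, hK, hKb⟩ := exists_uniform_bound hp hb
  have hlip : ∀ t x y, p t x - p t y ≤ K * dist x y := by
    intro t x y
    have h := (hp t).add_le (x - y) y
    rw [sub_add_cancel] at h
    rw [dist_eq_norm]
    linarith [hKb t (x - y)]
  choose c hc using hb
  obtain ⟨q, φ, hφ, hlim⟩ := exists_subseq_tendsto_of_lipschitz p K hK hlip c
    (fun t x => by rw [abs_of_nonneg ((hp t).nonneg x)]; exact hc x t)
  have hl : ∀ x, Tendsto (fun m => p (φ m) x) atTop (𝓝 (q x)) := tendsto_pi_nhds.1 hlim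
  refine ⟨q, ⟨fun x => ?_, fun x y => ?_, fun t ht x => ?_⟩, ?_, φ, hφ, hlim⟩
  · exact ge_of_tendsto' (hl x) fun m => (hp _).nonneg x
  · exact le_of_tendsto_of_tendsto' (hl _) ((hl x).add (hl y)) fun m => (hp _).add_le x y
  · refine tendsto_nhds_unique (hl _) (((hl x).const_mul t).congr fun m => ?_)
    rw [(hp _).smul_eq t ht]
  · have hql : ∀ x y, q x - q y ≤ K * dist x y := fun x y =>
      le_of_tendsto' ((hl x).sub (hl y)) fun m => hlip _ x y
    exact (LipschitzWith.of_dist_le' (K := K) fun x y => by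
      rw [Real.dist_eq, abs_le]
      have h1 := hql x y
      have h2 := hql y x
      rw [dist_comm y x] at h2
      constructor <;> linarith).continuous

/-! ### Gauges of translated convex sets -/

section Gauges

variable {n : ℕ} {f : EuclideanSpace ℝ (Fin n)} {B L : Set (EuclideanSpace ℝ (Fin n))}

theorem translate_mem_nhds_zero (hf : f ∈ interior B) : (fun x => x - f) '' B ∈ 𝓝 0 := by
  have h := (Homeomorph.subRight f).isOpenMap.image_mem_nhds (mem_interior_iff_mem_nhds.1 hf)
  simpa using h

theorem isNonnegSublinear_gaugeAt (hB : B ∈ FullDimClosedConvex n) (hf : f ∈ interior B) :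
    IsNonnegSublinear (gaugeAt f B) where
  nonneg := gauge_nonneg
  add_le := gauge_add_le (by simpa only [sub_eq_add_neg, add_comm] using hB.2.1.translate (-f))
    (absorbent_nhds_zero (translate_mem_nhds_zero hf))
  smul_eq t ht x := gauge_smul_of_nonneg ht x

theorem gaugeAt_sub_le_one {x : EuclideanSpace ℝ (Fin n)} (hx : x ∈ B) :
    gaugeAt f B (x - f) ≤ 1 :=
  gauge_le_one_of_mem ⟨x, hx, rfl⟩

/-- If a nonnegative sublinear functional is at most `β` on `L - f`, then it is at most `β` times
the gauge of `L - f`. -/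
theorem IsNonnegSublinear.le_mul_gaugeAt {p : EuclideanSpace ℝ (Fin n) → ℝ}
    (hp : IsNonnegSublinear p) (hf : f ∈ interior L) {β : ℝ} (hβ : 0 ≤ β)
    (h : ∀ x ∈ L, p (x - f) ≤ β) (r : EuclideanSpace ℝ (Fin n)) : p r ≤ β * gaugeAt f L r := by
  have key : ∀ ε > 0, p r ≤ β * (gaugeAt f L r + ε) := by
    intro ε hε
    obtain ⟨t, ht0, ht, y, ⟨x, hx, rfl⟩, rfl⟩ := exists_lt_of_gauge_lt
      (absorbent_nhds_zero (translate_mem_nhds_zero hf)) (lt_add_of_pos_right (gaugeAt f L r) hε)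
    have h1 : p (t • (x - f)) ≤ t * β := by
      rw [hp.smul_eq t ht0.le]
      exact mul_le_mul_of_nonneg_left (h x hx) ht0.le
    refine h1.trans ?_
    rw [mul_comm]
    exact mul_le_mul_of_nonneg_left ht.le hβ
  have hlim : Tendsto (fun ε : ℝ => β * (gaugeAt f L r + ε)) (𝓝[>] 0)
      (𝓝 (β * (gaugeAt f L r + 0))) :=
    ((continuous_const.mul (continuous_const.add continuous_id)).tendsto 0).mono_left
      nhdsWithin_le_nhds
  rw [add_zero] at hlim
  exact ge_of_tendsto hlim (eventually_mem_nhdsWithin.mono key)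

/-- The gauge of `L - f` vanishes on the generators of the recession cone of `L`. -/
theorem gaugeAt_eq_zero_of_recession {w : EuclideanSpace ℝ (Fin n)} {v : EuclideanSpace ℝ (Fin n)}
    (hL : L ∈ FullDimClosedConvex n) (hf : f ∈ interior L)
    (hw : ∀ t : ℝ, 0 ≤ t → v + t • w ∈ L) : gaugeAt f L w = 0 := by
  have hp := isNonnegSublinear_gaugeAt hL hf
  by_contra hne
  have hpos : 0 < gaugeAt f L w := lt_of_le_of_ne (hp.nonneg w) (Ne.symm hne)
  -- Far out on the ray the gauge would reach `c`, while subadditivity bounds it by `1 + gaugeAt f L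
  -- (f - v)`.
  let c := 2 + gaugeAt f L (f - v)
  have hc : 0 ≤ c / gaugeAt f L w := div_nonneg (by linarith [hp.nonneg (f - v)]) hpos.le
  have h1 := gaugeAt_sub_le_one (f := f) (hw _ hc)
  have h2 := hp.add_le (v + (c / gaugeAt f L w) • w - f) (f - v)
  rw [show v + (c / gaugeAt f L w) • w - f + (f - v) = (c / gaugeAt f L w) • w by abel,
    hp.smul_eq _ hc, div_mul_cancel₀ _ hne] at h2
  simp only [c] at h2
  linarith

/-- A continuous nonnegative sublinear functional is the gauge of some member of the family of
full-dimensional closed convex sets. -/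
theorem IsNonnegSublinear.mem_gaugeFamily {q : EuclideanSpace ℝ (Fin n) → ℝ}
    (hq : IsNonnegSublinear q) (hcont : Continuous q) (f : EuclideanSpace ℝ (Fin n)) :
    q ∈ gaugeFamily f (FullDimClosedConvex n) := by
  have hc : Continuous fun x => q (x - f) := hcont.comp (continuous_id.sub continuous_const)
  have hint : f ∈ interior {x | q (x - f) ≤ 1} := by
    refine interior_maximal (s := {x | q (x - f) ≤ 1}) (t := {x | q (x - f) < 1})
      (Set.ofPred_subset_ofPred.2 fun _ => le_of_lt) (isOpen_lt hc continuous_const) ?_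
    simp [hq.map_zero]
  refine ⟨{x | q (x - f) ≤ 1}, ⟨isClosed_le hc continuous_const, ?_, ?_⟩, hint, ?_⟩
  · intro x hx y hy a b ha hb hab
    have hseg : a • x + b • y ∈ convexHull ℝ {x | q (x - f) ≤ 1} :=
      convex_convexHull ℝ _ (subset_convexHull ℝ _ hx) (subset_convexHull ℝ _ hy) ha hb hab
    exact hq.le_of_mem_convexHull (fun v hv => hv) hseg
  · refine top_unique ?_
    rw [← isOpen_interior.affineSpan_eq_top ⟨f, hint⟩]
    exact affineSpan_mono ℝ interior_subset
  · have himg : (fun x => x - f) '' {x | q (x - f) ≤ 1} = {x | q x ≤ 1} := by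
      ext y
      constructor
      · rintro ⟨x, hx, rfl⟩
        exact hx
      · intro hy
        exact ⟨y + f, by simpa using hy, by simp⟩
    rw [gaugeAt, himg, hq.gauge_sublevel]

end Gauges

/-! ### Approximation factors and the two inequalities -/

section Rho

variable {n : ℕ} {f : EuclideanSpace ℝ (Fin n)} {B L : Set (EuclideanSpace ℝ (Fin n))}
  {𝓑 𝓛 : Set (Set (EuclideanSpace ℝ (Fin n)))}

theorem mem_inv_smul_iff {k : ℕ} {α : ℝ} (hα : 0 < α) {S : Set (Fin k → ℝ)} {s : Fin k → ℝ} :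
    s ∈ (1 / α) • S ↔ α • s ∈ S := by
  rw [one_div, Set.mem_inv_smul_set_iff₀ hα.ne']

theorem rhoSets_le_of_gaugeAt_le {β : ℝ} (hβ : 0 < β) (hB : f ∈ interior B)
    (h : ∀ r, gaugeAt f B r ≤ β * gaugeAt f L r) : rhoSets f B L ≤ ENNReal.ofReal β := by
  refine iInf₂_le β ⟨hβ, fun k _ R s hs => ?_⟩
  rw [mem_inv_smul_iff hβ]
  refine ⟨fun i => mul_nonneg hβ.le (hs.1 i), fun _ => (hs.2 hB).trans ?_⟩
  refine Finset.sum_le_sum fun i _ => ?_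
  calc s i * gaugeAt f B (R i) ≤ s i * (β * gaugeAt f L (R i)) :=
        mul_le_mul_of_nonneg_left (h _) (hs.1 i)
    _ = (β • s) i * gaugeAt f L (R i) := by simp only [Pi.smul_apply, smul_eq_mul]; ring

/-- The cut of `L` is then the whole orthant, so every positive factor is admissible. -/
theorem rhoSets_eq_zero (hf : f ∉ interior L) : rhoSets f B L = 0 := by
  refine le_antisymm (ENNReal.le_of_forall_pos_le_add fun ε hε _ => ?_) bot_le
  rw [zero_add, ← ENNReal.ofReal_coe_nnreal]
  refine iInf₂_le (ε : ℝ) ⟨hε, fun k _ R s hs => ?_⟩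
  rw [mem_inv_smul_iff (NNReal.coe_pos.2 hε)]
  exact ⟨fun i => mul_nonneg ε.2 (hs.1 i), fun h => absurd h hf⟩

/-- Admissibility passes to larger factors because gauges are nonnegative, so attainment of the
infimum is not needed. -/
theorem smul_mem_cut_of_rhoSets_lt {α : ℝ} (h : rhoSets f B L < ENNReal.ofReal α) {k : ℕ}
    (hk : 1 ≤ k) {R : Fin k → EuclideanSpace ℝ (Fin n)} {s : Fin k → ℝ} (hs : s ∈ cut B R f) :
    α • s ∈ cut L R f := by
  simp only [rhoSets, iInf_lt_iff] at h
  obtain ⟨a, ⟨ha, hsub⟩, hlt⟩ := h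
  have haα : a < α := (ENNReal.ofReal_lt_ofReal_iff_of_nonneg ha.le).1 hlt
  obtain ⟨h0, h1⟩ := (mem_inv_smul_iff ha).1 (hsub k hk R hs)
  refine ⟨fun i => mul_nonneg (ha.trans haα).le (hs.1 i), fun hf => (h1 hf).trans ?_⟩
  exact Finset.sum_le_sum fun i _ => mul_le_mul_of_nonneg_right
    (mul_le_mul_of_nonneg_right haα.le (hs.1 i)) (gauge_nonneg _)

/-- A factor strictly above the supremum lets a suitable `B` be chosen for each `L`. Only sets with
`f` in the interior impose a condition, and this sharper form is what part (b) needs. -/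
theorem rhoFamilies_le : rhoFamilies f 𝓑 𝓛 ≤
    ⨆ L ∈ 𝓛, ⨆ _ : f ∈ interior L, ⨅ B ∈ 𝓑, rhoSets f B L := by
  refine ENNReal.le_of_forall_pos_le_add fun ε hε hlt => ?_
  set S := ⨆ L ∈ 𝓛, ⨆ _ : f ∈ interior L, ⨅ B ∈ 𝓑, rhoSets f B L
  have hαpos : 0 < S.toReal + ε := by positivity
  have hα : ENNReal.ofReal (S.toReal + ε) = S + ε := by
    rw [ENNReal.ofReal_add ENNReal.toReal_nonneg ε.coe_nonneg, ENNReal.ofReal_toReal hlt.ne,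
      ENNReal.ofReal_coe_nnreal]
  rw [← hα]
  refine iInf₂_le _ ⟨hαpos, fun k hk R s hs => ?_⟩
  rw [mem_inv_smul_iff hαpos]
  have hnn : ∀ i, 0 ≤ ((S.toReal + ε) • s) i := fun i => mul_nonneg hαpos.le (hs.1 i)
  refine ⟨hnn, fun L hL => ?_⟩
  by_cases hf : f ∈ interior L
  · have hle : ⨅ B ∈ 𝓑, rhoSets f B L ≤ S :=
      le_iSup₂_of_le L hL (le_iSup_of_le hf le_rfl)
    have hlt' : ⨅ B ∈ 𝓑, rhoSets f B L < ENNReal.ofReal (S.toReal + ε) := by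
      rw [hα]
      exact hle.trans_lt (ENNReal.lt_add_right hlt.ne (by exact_mod_cast hε.ne'))
    simp only [iInf_lt_iff] at hlt'
    obtain ⟨B, hB, hBlt⟩ := hlt'
    exact smul_mem_cut_of_rhoSets_lt hBlt hk (hs.2 B hB)
  · exact ⟨hnn, fun h => absurd h hf⟩

/-- If the closure of `𝓑` approximates that of `𝓛` with factor `α`, then for every `c > 0` some
member of `𝓑` has gauge at most `N α` on the vertices of `L` and at most `c⁻¹` on its rays. -/
theorem exists_gaugeAt_le_on_generators {N : ℕ} (hL : L ∈ 𝓛) (hLC : L ∈ FullDimClosedConvex n)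
    (hf : f ∈ interior L) {α : ℝ} (hα : 0 < α)
    (hsub : ∀ k : ℕ, 1 ≤ k → ∀ R : Fin k → EuclideanSpace ℝ (Fin n),
      cutClosure 𝓑 R f ⊆ (1 / α) • cutClosure 𝓛 R f)
    {V W : Finset (EuclideanSpace ℝ (Fin n))} (hV : V.Nonempty) (hcard : V.card + W.card + 1 ≤ N)
    (hrep : L = convexHull ℝ (V : Set (EuclideanSpace ℝ (Fin n))) +
      (PointedCone.hull ℝ (W : Set (EuclideanSpace ℝ (Fin n))) :
        Set (EuclideanSpace ℝ (Fin n)))) {c : ℝ} (hc : 0 < c) :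
    ∃ B ∈ 𝓑, f ∈ interior B ∧ (∀ v ∈ V, gaugeAt f B (v - f) ≤ N * α) ∧
      ∀ w ∈ W, gaugeAt f B w ≤ c⁻¹ := by
  by_contra hcon
  push Not at hcon
  have hVL : ∀ v ∈ V, v ∈ L := fun v hv => by
    rw [hrep]
    exact ⟨v, subset_convexHull ℝ _ hv, 0, Submodule.zero_mem _, add_zero v⟩
  have hW0 : ∀ w ∈ W, gaugeAt f L w = 0 := by
    intro w hw
    obtain ⟨v, hv⟩ := hV
    refine gaugeAt_eq_zero_of_recession (v := v) hLC hf fun t ht => ?_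
    rw [hrep]
    exact ⟨v, subset_convexHull ℝ _ hv, t • w,
      Submodule.smul_mem _ (⟨t, ht⟩ : {x : ℝ // 0 ≤ x}) (Submodule.subset_span hw), rfl⟩
  have hNpos : 0 < (N : ℝ) := by
    have : 0 < N := by omega
    exact_mod_cast this
  have hβ : 0 < N * α := mul_pos hNpos hα
  let e : Fin (Fintype.card (V ⊕ W)) ≃ V ⊕ W := (Fintype.equivFin _).symm
  let R₀ : V ⊕ W → EuclideanSpace ℝ (Fin n) := Sum.elim (fun v => v - f) (fun w => w)
  let s₀ : V ⊕ W → ℝ := Sum.elim (fun _ => (N * α)⁻¹) (fun _ => c)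
  have hs₀ : ∀ i, 0 ≤ s₀ i := by
    rintro (v | w)
    · exact (inv_pos.2 hβ).le
    · exact hc.le
  have hk : 1 ≤ Fintype.card (V ⊕ W) := by
    have := hV.card_pos
    simp only [Fintype.card_sum, Fintype.card_coe]
    omega
  have hsum : ∀ (a : ℝ) (g : EuclideanSpace ℝ (Fin n) → ℝ),
      ∑ i, (a * s₀ (e i)) * g (R₀ (e i)) = ∑ i, (a * s₀ i) * g (R₀ i) := fun a g =>
    e.sum_comp fun i => (a * s₀ i) * g (R₀ i)
  have hmem : (fun i => s₀ (e i)) ∈ cutClosure 𝓑 (fun i => R₀ (e i)) f := by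
    -- If no `B` satisfies the claim, each one has a generator whose single term is already at least
    -- `1`.
    refine ⟨fun i => hs₀ _, fun B hB => ⟨fun i => hs₀ _, fun hfB => ?_⟩⟩
    have hle : ∀ i, 1 ≤ s₀ i * gaugeAt f B (R₀ i) →
        1 ≤ ∑ i, s₀ (e i) * gaugeAt f B (R₀ (e i)) := fun i hi => by
      rw [e.sum_comp fun i => s₀ i * gaugeAt f B (R₀ i)]
      exact hi.trans (Finset.single_le_sum (f := fun i => s₀ i * gaugeAt f B (R₀ i))
        (fun j _ => mul_nonneg (hs₀ j) (gauge_nonneg _)) (Finset.mem_univ i))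
    by_cases hall : ∀ v ∈ V, gaugeAt f B (v - f) ≤ N * α
    · obtain ⟨w, hw, hlt⟩ := hcon B hB hfB hall
      refine hle (Sum.inr ⟨w, hw⟩) ?_
      change 1 ≤ c * gaugeAt f B w
      rw [← mul_inv_cancel₀ hc.ne']
      exact mul_le_mul_of_nonneg_left hlt.le hc.le
    · push Not at hall
      obtain ⟨v, hv, hlt⟩ := hall
      refine hle (Sum.inl ⟨v, hv⟩) ?_
      change 1 ≤ (N * α)⁻¹ * gaugeAt f B (v - f)
      rw [← inv_mul_cancel₀ hβ.ne']
      exact mul_le_mul_of_nonneg_left hlt.le (inv_pos.2 hβ).le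
  have h1 := ((mem_inv_smul_iff hα).1 (hsub _ hk _ hmem)).2 L hL |>.2 hf
  have h2 : ∑ i, (α * s₀ (e i)) * gaugeAt f L (R₀ (e i)) ≤ V.card / N := by
    rw [hsum α, Fintype.sum_sum_type]
    have hr : ∑ w : W, α * s₀ (Sum.inr w) * gaugeAt f L (R₀ (Sum.inr w)) = 0 :=
      Finset.sum_eq_zero fun w _ => by
        change α * c * gaugeAt f L w = 0
        rw [hW0 w w.2, mul_zero]
    have hl : ∑ v : V, α * s₀ (Sum.inl v) * gaugeAt f L (R₀ (Sum.inl v)) ≤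
        ∑ v : V, 1 / (N : ℝ) := by
      refine Finset.sum_le_sum fun v _ => ?_
      change α * (N * α)⁻¹ * gaugeAt f L (v - f) ≤ 1 / N
      have hαN : α * (N * α)⁻¹ = 1 / (N : ℝ) := by field_simp
      rw [hαN]
      exact mul_le_of_le_one_right (by positivity) (gaugeAt_sub_le_one (hVL v v.2))
    rw [hr, add_zero]
    refine hl.trans_eq ?_
    simp [div_eq_mul_inv]
  -- The `+ 1` in the bound on `N` makes this strict even when `W` is empty.
  have h3 : (V.card : ℝ) / N < 1 := by
    rw [div_lt_one hNpos]
    exact_mod_cast (by omega : V.card < N)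
  exact absurd (h1.trans h2) (not_le.2 h3)

/-- If the closure of an `f`-closed family `𝓑` approximates that of `𝓛` with factor `α`, then a
single member of `𝓑` approximates `L ∈ 𝓛` with factor `N α`. -/
theorem exists_rhoSets_le {N : ℕ} (h𝓑 : 𝓑 ⊆ FullDimClosedConvex n) (hcl : IsFClosed f 𝓑)
    (hL : L ∈ 𝓛) (hLC : L ∈ FullDimClosedConvex n) (hrep : HasRepresentation N L)
    (hf : f ∈ interior L) {α : ℝ} (hα : 0 < α)
    (hsub : ∀ k : ℕ, 1 ≤ k → ∀ R : Fin k → EuclideanSpace ℝ (Fin n),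
      cutClosure 𝓑 R f ⊆ (1 / α) • cutClosure 𝓛 R f) :
    ∃ B ∈ 𝓑, rhoSets f B L ≤ ENNReal.ofReal (N * α) := by
  obtain ⟨V, W, hV, -, hcard, hLeq⟩ := hrep
  have hβ : 0 < N * α := mul_pos (by exact_mod_cast (by omega : 0 < N)) hα
  choose B hB hfB hBV hBW using fun m : ℕ => exists_gaugeAt_le_on_generators hL hLC hf hα hsub
    hV hcard hLeq (show (0 : ℝ) < (m : ℝ) + 1 by positivity)
  have hp : ∀ m, IsNonnegSublinear (gaugeAt f (B m)) := fun m =>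
    isNonnegSublinear_gaugeAt (h𝓑 (hB m)) (hfB m)
  have hW1 : ∀ m, ∀ w ∈ (W : Set (EuclideanSpace ℝ (Fin n))), gaugeAt f (B m) w ≤ 1 :=
    fun m w hw => (hBW m w hw).trans
      (inv_le_one_of_one_le₀ (by linarith [Nat.cast_nonneg (α := ℝ) m]))
  have hLbound : ∀ x ∈ L, ∃ d, ∀ m, gaugeAt f (B m) (x - f) ≤ d := by
    intro x hx
    rw [hLeq] at hx
    obtain ⟨y, hy, z, hz, rfl⟩ := hx
    obtain ⟨d, hd⟩ := IsNonnegSublinear.exists_bound_of_mem_hull hp hW1 hz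
    refine ⟨N * α + d, fun m => ?_⟩
    change gaugeAt f (B m) (y + z - f) ≤ _
    rw [add_sub_right_comm]
    exact ((hp m).add_le _ _).trans (add_le_add ((hp m).le_of_mem_convexHull (hBV m) hy) (hd m))
  -- Since `f` is interior to `L`, every vector is a positive multiple of a point of `L - f`.
  have hbound : ∀ r, ∃ d, ∀ m, gaugeAt f (B m) r ≤ d := by
    intro r
    obtain ⟨t, ht, -, y, ⟨x, hx, rfl⟩, rfl⟩ := exists_lt_of_gauge_lt
      (absorbent_nhds_zero (translate_mem_nhds_zero hf)) (lt_add_one (gaugeAt f L r))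
    obtain ⟨d, hd⟩ := hLbound x hx
    exact ⟨t * d, fun m => ((hp m).smul_eq t ht.le _).trans_le
      (mul_le_mul_of_nonneg_left (hd m) ht.le)⟩
  obtain ⟨q, hq, hqc, φ, hφ, hlim⟩ := IsNonnegSublinear.exists_subseq_tendsto hp hbound
  have hl := tendsto_pi_nhds.1 hlim
  obtain ⟨C, hC, hfC, hqC⟩ := hcl (fun m => gaugeAt f (B (φ m)))
    (fun m => ⟨B (φ m), hB _, hfB _, rfl⟩) q (hq.mem_gaugeFamily hqc f) hlim
  refine ⟨C, hC, rhoSets_le_of_gaugeAt_le hβ hfC ?_⟩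
  rw [← hqC]
  have hqV : ∀ v ∈ (V : Set (EuclideanSpace ℝ (Fin n))), q (v - f) ≤ N * α := fun v hv =>
    le_of_tendsto' (hl _) fun m => hBV _ v hv
  have hqW : ∀ w ∈ (W : Set (EuclideanSpace ℝ (Fin n))), q w ≤ 0 := by
    intro w hw
    have h0 : Tendsto (fun m : ℕ => ((φ m : ℝ) + 1)⁻¹) atTop (𝓝 0) := by
      have h := (tendsto_one_div_add_atTop_nhds_zero_nat (𝕜 := ℝ)).comp hφ.tendsto_atTop
      simpa only [one_div, Function.comp_def] using h
    exact le_of_tendsto_of_tendsto' (hl w) h0 fun m => hBW _ w hw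
  refine hq.le_mul_gaugeAt hf hβ.le fun x hx => ?_
  rw [hLeq] at hx
  obtain ⟨y, hy, z, hz, rfl⟩ := hx
  have h1 := hq.add_le (y - f) z
  have h2 := hq.le_of_mem_convexHull hqV hy
  have h3 := hq.nonpos_of_mem_hull hqW hz
  change q (y + z - f) ≤ _
  rw [add_sub_right_comm]
  linarith

theorem iInf_rhoSets_le_mul_rhoFamilies {N : ℕ} (h𝓑 : 𝓑 ⊆ FullDimClosedConvex n)
    (hcl : IsFClosed f 𝓑) (hL : L ∈ 𝓛) (hLC : L ∈ FullDimClosedConvex n)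
    (hrep : HasRepresentation N L) (hf : f ∈ interior L) :
    1 / (N : ℝ≥0∞) * ⨅ B ∈ 𝓑, rhoSets f B L ≤ rhoFamilies f 𝓑 𝓛 := by
  have hN : N ≠ 0 := by
    obtain ⟨V, W, -, -, h, -⟩ := hrep
    omega
  refine le_iInf₂ fun α hα => ?_
  obtain ⟨B, hB, hle⟩ := exists_rhoSets_le h𝓑 hcl hL hLC hrep hf hα.1 hα.2
  rw [ENNReal.ofReal_mul (Nat.cast_nonneg N), ENNReal.ofReal_natCast] at hle
  calc 1 / (N : ℝ≥0∞) * ⨅ B ∈ 𝓑, rhoSets f B L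
      ≤ 1 / (N : ℝ≥0∞) * (N * ENNReal.ofReal α) := by gcongr; exact (iInf₂_le B hB).trans hle
    _ = ENNReal.ofReal α := by
      rw [← mul_assoc, one_div, ENNReal.inv_mul_cancel (by exact_mod_cast hN)
        (ENNReal.natCast_ne_top N), one_mul]

end Rho

theorem theorem4p4 (n N : ℕ) (hN : 1 ≤ N)
    (𝓑 𝓛 : Set (Set (EuclideanSpace ℝ (Fin n))))
    (h𝓑 : 𝓑 ⊆ FullDimClosedConvex n) (h𝓛 : 𝓛 ⊆ FullDimClosedConvex n)
    (hrep : ∀ L ∈ 𝓛, HasRepresentation N L) :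
    (∀ f : EuclideanSpace ℝ (Fin n), f ∉ integerLattice n → IsFClosed f 𝓑 →
      ((𝓑.Nonempty ∨ ∃ L ∈ 𝓛, f ∈ interior L) →
        1 / (N : ℝ≥0∞) * (⨆ L ∈ 𝓛, ⨅ B ∈ 𝓑, rhoSets f B L) ≤ rhoFamilies f 𝓑 𝓛) ∧
      rhoFamilies f 𝓑 𝓛 ≤ ⨆ L ∈ 𝓛, ⨅ B ∈ 𝓑, rhoSets f B L) ∧
    ((∀ f : EuclideanSpace ℝ (Fin n), f ∉ integerLattice n → IsFClosed f 𝓑) →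
      1 / (N : ℝ≥0∞) * (⨆ L ∈ 𝓛, ⨆ f ∈ interior L \ integerLattice n,
          ⨅ B ∈ 𝓑, rhoSets f B L) ≤ rhoAll 𝓑 𝓛 ∧
      rhoAll 𝓑 𝓛 ≤ ⨆ L ∈ 𝓛, ⨆ f ∈ interior L \ integerLattice n,
          ⨅ B ∈ 𝓑, rhoSets f B L) := by
  refine ⟨fun f _ hcl => ⟨fun hne => ?_, ?_⟩, fun hcl => ⟨?_, ?_⟩⟩
  · simp only [ENNReal.mul_iSup]
    refine iSup₂_le fun L hL => ?_
    by_cases hf : f ∈ interior L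
    · exact iInf_rhoSets_le_mul_rhoFamilies h𝓑 hcl hL (h𝓛 hL) (hrep L hL) hf
    · by_cases hB : 𝓑.Nonempty
      · obtain ⟨B, hB⟩ := hB
        have h0 : ⨅ B ∈ 𝓑, rhoSets f B L = 0 :=
          le_antisymm ((iInf₂_le B hB).trans_eq (rhoSets_eq_zero hf)) bot_le
        rw [h0, mul_zero]
        exact bot_le
      -- With `𝓑` empty the inner infimum is `∞` for every set, so the bound for `L'` also serves
      -- for `L`.
      · obtain ⟨L', hL', hf'⟩ := hne.resolve_left hB
        have h := iInf_rhoSets_le_mul_rhoFamilies h𝓑 hcl hL' (h𝓛 hL') (hrep L' hL') hf'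
        refine le_trans ?_ h
        simp [Set.not_nonempty_iff_eq_empty.1 hB]
  · exact rhoFamilies_le.trans (iSup₂_mono fun L _ => iSup_le fun _ => le_rfl)
  · simp only [ENNReal.mul_iSup]
    exact iSup₂_le fun L hL => iSup₂_le fun f hf =>
      (iInf_rhoSets_le_mul_rhoFamilies h𝓑 (hcl f hf.2) hL (h𝓛 hL) (hrep L hL) hf.1).trans
        (le_iSup₂_of_le f hf.2 le_rfl)
  · refine iSup₂_le fun f hf => rhoFamilies_le.trans ?_
    exact iSup₂_mono fun L _ => iSup_le fun hfL =>
      le_iSup₂_of_le (f := fun f (_ : f ∈ interior L \ integerLattice n) =>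
        ⨅ B ∈ 𝓑, rhoSets f B L) f ⟨hfL, hf⟩ le_rfl
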